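/- Let $\mathfrak c=2^{\aleph_0}$ and let $\omega^*=\beta\omega\setminus\omega$ be the space of non-principal ultrafilters on $\omega$, as a subspace of the Stone space $\beta\omega$ of all ultrafilters on $\omega$. All filters on $\omega$ are proper and contain every cofinite set. For a filter $\mathcal F$ on $\omega$ let $K_{\mathcal F}=\{p\in\omega^*:\mathcal F\subseteq p\}$, and let $\xi(\mathcal F)=\omega\cup\{\mathcal F\}$ be the space in which all points of $\omega$ are isolated and the neighborhoods of the point $\mathcal F$ are the sets $\{\mathcal F\}\cup A$ with $A\in\mathcal F$. The filter $\mathcal F$ is called reversible if every continuous bijection of $\xi(\mathcal F)$ onto itself is a homeomorphism. A tower of height $\kappa$ is a family $\{A_\alpha:\alpha<\kappa\}$ of subsets of $\omega$ such that $A_\beta\setminus A_\alpha$ is finite whenever $\alpha<\beta<\kappa$, and such that there is no infinite $A\subseteq\omega$ with $A\setminus A_\alpha$ finite for all $\alpha<\kappa$. The filter generated by a tower is the smallest filter containing all its members and all cofinite subsets of $\omega$. A closed subset $K$ of a space is a $P$-set if the intersection of any countably many neighborhoods of $K$ is a neighborhood of $K$. **Theorem.** Assume Martin's Axiom: for every non-empty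 partially ordered set with the countable chain condition and every family of fewer than $\mathfrak c$ dense subsets of it, there is a filter of the partial order that meets every member of the family. Let $X$ be a non-empty, separable, compact Hausdorff space that is extremally disconnected (the closure of every open set is open). Then there is a reversible filter $\mathcal F$ on $\omega$, generated by a tower of height $\mathfrak c$, such that $K_{\mathcal F}$ is a $P$-set of $\omega^*$ homeomorphic to $X$. -/

import Mathlib

open Set Filter Topology Cardinal

/-- A subset `D` of a preorder is dense (in the sense of forcing) if every element of the
preorder has an element of `D` below it. -/
def ForcingDense {P : Type*} [Preorder P] (D : Set P) : Prop :=
  ∀ p : P, ∃ q ∈ D, q ≤ p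

/-- The countable chain condition: every set of pairwise incompatible elements is countable,
where `p` and `q` are incompatible if there is no `r` with `r ≤ p` and `r ≤ q`. -/
def ForcingCCC (P : Type*) [Preorder P] : Prop :=
  ∀ A : Set P, (∀ p ∈ A, ∀ q ∈ A, p ≠ q → ¬ ∃ r : P, r ≤ p ∧ r ≤ q) → A.Countable

/-- Martin's Axiom: for every non-empty preorder with the countable chain condition and every
family of fewer than `𝔠` dense subsets, some filter of the preorder (a non-empty, upward closed,
downward directed subset) meets all members of the family. -/
def MartinsAxiom : Prop :=
  ∀ (P : Type) [Preorder P] [Nonempty P], ForcingCCC P →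
    ∀ 𝒟 : Set (Set P), #𝒟 < 𝔠 → (∀ D ∈ 𝒟, ForcingDense D) →
      ∃ G : Order.PFilter P, ∀ D ∈ 𝒟, ∃ p ∈ D, p ∈ G

/-- A space is reversible if every continuous bijection of it onto itself is a homeomorphism. -/
def ReversibleSpace (Y : Type*) [TopologicalSpace Y] : Prop :=
  ∀ f : Y → Y, Continuous f → Function.Bijective f → IsHomeomorph f

/-- The underlying set of the space `ξ(F) = ω ∪ {F}`; `none` plays the role of the point `F`. -/
def FilterSpace (_F : Filter ℕ) : Type := Option ℕ

/-- The topology of `ξ(F)`: the points of `ω` are isolated, and the neighbourhoods of the extra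
point are the sets that contain it and whose trace on `ω` belongs to `F`. -/
instance FilterSpace.instTopologicalSpace (F : Filter ℕ) : TopologicalSpace (FilterSpace F) where
  IsOpen U := (none : Option ℕ) ∈ U → {n : ℕ | (some n : Option ℕ) ∈ U} ∈ F
  isOpen_univ := fun _ => Filter.univ_mem
  isOpen_inter := fun _ _ hs ht h => Filter.inter_mem (hs h.1) (ht h.2)
  isOpen_sUnion := by
    rintro S hS ⟨s, hs, h⟩
    exact Filter.mem_of_superset (hS s hs h) fun n hn => ⟨s, hs, hn⟩

/-- A filter `F` on `ω` is reversible if the space `ξ(F)` is reversible. -/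
def ReversibleFilter (F : Filter ℕ) : Prop :=
  ReversibleSpace (FilterSpace F)

/-- `ω* = βω \ ω`, the space of ultrafilters on `ω` that are not principal, as a subspace of the
Stone space `βω` of all ultrafilters on `ω`. -/
abbrev OmegaStar : Type := {p : Ultrafilter ℕ // p ∉ range (pure : ℕ → Ultrafilter ℕ)}

/-- `K_F`, the set of all ultrafilters that contain `F`. It is used for filters `F` that contain
all cofinite sets; every ultrafilter that contains such an `F` lies in `ω*`. -/
def stoneSet (F : Filter ℕ) : Set OmegaStar :=
  {p | ∀ A ∈ F, A ∈ p.1}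

/-- A closed set `K` is a `P`-set of the space `Y` if the intersection of any countably many
neighbourhoods of `K` is a neighbourhood of `K`. -/
def IsPSet {Y : Type*} [TopologicalSpace Y] (K : Set Y) : Prop :=
  IsClosed K ∧ ∀ U : ℕ → Set Y, (∀ n, U n ∈ 𝓝ˢ K) → (⋂ n, U n) ∈ 𝓝ˢ K

/-- A tower of height `κ`: a family of subsets of `ω`, indexed by the ordinals below `κ`, that is
decreasing modulo finite sets and has no infinite pseudointersection. -/
def IsTower (κ : Ordinal.{0}) (A : Iio κ → Set ℕ) : Prop :=
  (∀ α β : Iio κ, α < β → (A β \ A α).Finite) ∧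
    ¬ ∃ B : Set ℕ, B.Infinite ∧ ∀ α : Iio κ, (B \ A α).Finite

/-- `F` is generated by a tower of height `κ`: it is the smallest filter that contains all
cofinite sets and all members of some tower of height `κ`. -/
def GeneratedByTower (κ : Ordinal.{0}) (F : Filter ℕ) : Prop :=
  ∃ A : Iio κ → Set ℕ, IsTower κ A ∧ F = Filter.generate (cofinite.sets ∪ range A)

/-!
The filter is built together with its homeomorphism to `X`: every point `x` of `X` is assigned
sets `W γ x ⊆ ℕ`, indexed by `γ < 𝔠` and locally constant in `x`, such that for each `x` all
finite intersections of the sets `W γ x` are infinite (`StrongFIP`). The tower consists of the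
unions `A γ = ⋃ x, W γ x`, and the homeomorphism from `X` to `K_F` sends `x` to the unique
ultrafilter that contains all `W γ x`. The sets `W γ` are chosen by recursion, and each step meets
requirements (`IsStep`) assigned to it by a list of all triples of a set `S ⊆ ℕ`, a clopen `a ⊆ X`
and a permutation `h` of `ℕ`. There are only `𝔠` triples, since clopen sets are determined by
their traces on a countable dense set.

* For some clopen `c`, the numbers in `W γ x` belong to `S` if and only if `x ∈ c`. This makes the
  ultrafilter of `x` unique and continuous in `x`. To preserve the strong finite intersection
  property, `c` is taken to be the complement of the closure of the set of all `x` at which `S`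
  cannot be adjoined; it is clopen by extremal disconnectedness
  (`exists_isClopen_strongFIP_option`).
* `W γ x` and `W γ y` are disjoint if `x ∈ a` and `y ∉ a`, so that the ultrafilters of different
  points differ.
* For any finitely many earlier indices `i`, almost every `k ∈ A γ` has a common `x` with
  `k ∈ W i x` for all these `i`. So the `A γ` decrease modulo finite sets, and by compactness of `X` every
  ultrafilter that contains all of them is the ultrafilter of some `x`.
* `S \ A γ` is infinite if `S` is, so that the tower has no infinite pseudointersection.
* If `k` and `h k` are both in `A γ`, then `h k = k`. Hence a permutation that maps the filter into
  itself is the identity on a set in the filter, and the filter is reversible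
  (`reversibleFilter_of_forall_perm`).

Such a `W γ` is read off from a generic partial two-colouring of `ℕ`, approximated by finite stems
together with finitely many promises (`Approx`). Approximations with equal stems are compatible, so
that the countable chain condition holds. Although there may be `2 ^ 𝔠` points `x`, only finitely
many patterns occur on any finite set of indices, so that fewer than `𝔠` dense sets suffice
(`MartinsAxiom.exists_extension`). Finally `K_F` is a `P`-set because `𝔠` has uncountable
cofinality.
-/

/-! ### The strong finite intersection property -/

/-- The family `W` of sets depending on a parameter `x` has the strong finite intersection
property at every parameter: all its finite intersections are infinite. -/
def StrongFIP {I X : Type*} (W : I → X → Set ℕ) : Prop :=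
  ∀ (x : X) (Q : Finset I), {k | ∀ i ∈ Q, k ∈ W i x}.Infinite

/-- Some parameter of colour `b` has `k` in all the sets indexed by `Q`. -/
def Admissible {I X : Type*} (W : I → X → Set ℕ) (χ : X → Bool) (Q : Finset I) (k : ℕ)
    (b : Bool) : Prop :=
  ∃ x, χ x = b ∧ ∀ i ∈ Q, k ∈ W i x

lemma Admissible.mono {I X : Type*} {W : I → X → Set ℕ} {χ : X → Bool} {Q R : Finset I} {k : ℕ}
    {b : Bool} (h : Admissible W χ R k b) (hQR : Q ⊆ R) : Admissible W χ Q k b :=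
  let ⟨x, hx, hk⟩ := h
  ⟨x, hx, fun i hi => hk i (hQR hi)⟩

/-! ### Approximations of a two-colouring -/

/-- Finite approximations to a partial two-colouring of `ℕ`. The stem decides the numbers below
its length: `some b` is the colour `b`, and `none` leaves the number uncoloured. The side is a
finite set of promises restricting the numbers coloured later on. No coloured number is moved
by `h` to another coloured number. -/
structure Approx {I X : Type*} (W : I → X → Set ℕ) (χ : X → Bool) (h : Equiv.Perm ℕ) where
  stem : List (Option Bool)
  side : Finset I
  free : ∀ k b b', stem[k]? = some (some b) → stem[h k]? = some (some b') → h k = k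

namespace Approx

variable {I X : Type*} {W : I → X → Set ℕ} {χ : X → Bool} {h : Equiv.Perm ℕ}

/-- A stronger approximation extends the stem and the side, and the newly coloured numbers keep the
promises in the old side. -/
instance : Preorder (Approx W χ h) where
  le q p := p.stem <+: q.stem ∧ p.side ⊆ q.side ∧
    ∀ k b, p.stem.length ≤ k → q.stem[k]? = some (some b) → Admissible W χ p.side k b
  le_refl p := ⟨List.prefix_rfl, subset_rfl, fun k b hk hb => by
    rw [List.getElem?_eq_none hk] at hb; cases hb⟩
  le_trans r q p hrq hqp := ⟨hqp.1.trans hrq.1, hqp.2.1.trans hrq.2.1, fun k b hk hb => by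
    by_cases hkq : k < q.stem.length
    · refine hqp.2.2 k b hk ?_
      rw [List.prefix_iff_getElem?.1 hrq.1 k hkq] at hb
      rw [List.getElem?_eq_getElem hkq, hb]
    · exact (hrq.2.2 k b (not_lt.1 hkq) hb).mono hqp.2.1⟩

lemma le_def {p q : Approx W χ h} : q ≤ p ↔ p.stem <+: q.stem ∧ p.side ⊆ q.side ∧
    ∀ k b, p.stem.length ≤ k → q.stem[k]? = some (some b) → Admissible W χ p.side k b :=
  Iff.rfl

instance : Nonempty (Approx W χ h) := ⟨⟨[], ∅, by simp⟩⟩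

lemma getElem?_of_le {p q : Approx W χ h} (hqp : q ≤ p) {k : ℕ} {v : Option Bool}
    (hv : p.stem[k]? = some v) : q.stem[k]? = some v := by
  obtain ⟨hk, rfl⟩ := List.getElem?_eq_some_iff.1 hv
  exact List.prefix_iff_getElem?.1 hqp.1 k hk

/-- Enlarging the side alone gives a stronger approximation. -/
lemma exists_le_side [DecidableEq I] (p : Approx W χ h) (Q : Finset I) :
    ∃ q ≤ p, q.stem = p.stem ∧ q.side = p.side ∪ Q :=
  ⟨⟨p.stem, p.side ∪ Q, p.free⟩, ⟨List.prefix_rfl, Finset.subset_union_left,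
    fun k b hk hb => by rw [List.getElem?_eq_none hk] at hb; cases hb⟩, rfl, rfl⟩

/-- The countable chain condition holds since approximations with the same stem are compatible
and there are only countably many stems. -/
lemma forcingCCC : ForcingCCC (Approx W χ h) := by
  classical
  intro A hA
  refine Set.countable_of_injective_of_countable_image (f := stem) ?_ (Set.to_countable _)
  intro p hp q hq hpq
  by_contra hne
  obtain ⟨r, hr, hrs, hrQ⟩ := exists_le_side p q.side
  refine hA p hp q hq hne ⟨r, hr, le_def.2 ⟨?_, ?_, ?_⟩⟩
  · rw [hrs, hpq]
  · rw [hrQ]; exact Finset.subset_union_right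
  · intro k b hk hb
    rw [hrs, hpq, List.getElem?_eq_none hk] at hb
    cases hb

/-- The approximation can be extended by leaving all numbers uncoloured up to `k`, which gets the
value `v`; colouring `k` requires that `k` keep the promises and be moved by `h` and its inverse
to undecided numbers. -/
lemma exists_le_getElem? (p : Approx W χ h) {k : ℕ} (hk : p.stem.length ≤ k) (v : Option Bool)
    (hv : ∀ b, v = some b → Admissible W χ p.side k b)
    (hfree : v ≠ none → p.stem.length ≤ h k ∧ p.stem.length ≤ h.symm k) :
    ∃ q ≤ p, q.stem[k]? = some v := by
  set s := p.stem ++ (List.replicate (k - p.stem.length) none ++ [v]) with hs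
  have hlt : ∀ j, j < p.stem.length → s[j]? = p.stem[j]? := fun j hj =>
    List.getElem?_append_left hj
  have hsk : s[k]? = some v := by
    rw [hs, List.getElem?_append_right hk, List.getElem?_append_right (by simp)]
    simp
  have hge : ∀ j b, p.stem.length ≤ j → s[j]? = some (some b) → j = k := by
    intro j b hj hb
    rw [hs, List.getElem?_append_right hj] at hb
    by_cases hjk : j < k
    · rw [List.getElem?_append_left (by simp; omega),
        List.getElem?_replicate_of_lt (by omega)] at hb
      cases hb
    · by_contra hne
      rw [List.getElem?_eq_none (by simp; omega)] at hb
      cases hb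
  have hcol : ∀ b, s[k]? = some (some b) → v ≠ none := by
    rintro b hb rfl
    rw [hsk] at hb; cases hb
  refine ⟨⟨s, p.side, ?_⟩, ⟨List.prefix_append _ _, subset_rfl, ?_⟩, hsk⟩
  · intro j b b' hj hj'
    by_cases hjl : j < p.stem.length
    · by_cases hhl : h j < p.stem.length
      · rw [hlt _ hjl] at hj
        rw [hlt _ hhl] at hj'
        exact p.free j b b' hj hj'
      · have e := hge _ _ (not_lt.1 hhl) hj'
        have := (hfree (hcol b' (e ▸ hj'))).2
        rw [← e, Equiv.symm_apply_apply] at this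
        omega
    · have e := hge _ _ (not_lt.1 hjl) hj
      subst e
      exact hge _ _ (hfree (hcol b hj)).1 hj'
  · intro j b hj hb
    have e := hge j b hj hb
    subst e
    rw [hsk] at hb
    exact hv b (Option.some.inj hb)

/-- Under the strong finite intersection property, a number in prescribed sets of the family can
be given the colour of the parameter. -/
lemma exists_le_colour (hW : StrongFIP W) (p : Approx W χ h) (Q : Finset I) (x : X) (m : ℕ) :
    ∃ q ≤ p, ∃ k ≥ m, q.stem[k]? = some (some (χ x)) ∧ ∀ i ∈ Q, k ∈ W i x := by
  classical
  have hfin : ({k | k < m} ∪ {k | k < p.stem.length} ∪ h ⁻¹' {k | k < p.stem.length} ∪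
      h.symm ⁻¹' {k | k < p.stem.length}).Finite :=
    (((finite_lt_nat _).union (finite_lt_nat _)).union
      ((finite_lt_nat _).preimage h.injective.injOn)).union
      ((finite_lt_nat _).preimage h.symm.injective.injOn)
  obtain ⟨k, hk, hk'⟩ := ((hW x (p.side ∪ Q)).sdiff hfin).nonempty
  simp only [mem_union, mem_ofPred_eq, mem_preimage, not_or, not_lt] at hk hk'
  obtain ⟨q, hq, hqk⟩ := exists_le_getElem? p hk'.1.1.2 (some (χ x))
    (by rintro b ⟨⟩; exact ⟨x, rfl, fun i hi => hk i (Finset.mem_union_left _ hi)⟩)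
    (fun _ => ⟨hk'.1.2, hk'.2⟩)
  exact ⟨q, hq, k, hk'.1.1.1, hqk, fun i hi => hk i (Finset.mem_union_right _ hi)⟩

end Approx

/-! ### The application of Martin's Axiom -/

lemma mk_finset_lt_continuum {I : Type*} (hI : #I < 𝔠) : #(Finset I) < 𝔠 := by
  rcases finite_or_infinite I with h | h
  · exact (lt_aleph0_of_finite _).trans aleph0_lt_continuum
  · rwa [mk_finset_of_infinite]

/-- The use of Martin's Axiom: a family of fewer than `𝔠` sets with the strong finite intersection
property at every parameter is extended by a member `x ↦ Y (χ x)`, such that almost every number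
in `Y b` lies in prescribed finitely many sets at a common parameter of colour `b`. Moreover the
union of the `Y b` omits infinitely many elements of `Z` and is moved off itself by `h`, up to
fixed points. -/
lemma MartinsAxiom.exists_extension (hMA : MartinsAxiom) {I : Type} {X : Type*} [Nonempty X]
    (hI : #I < 𝔠) {W : I → X → Set ℕ} (hW : StrongFIP W) (χ : X → Bool)
    (hfin : ∀ Q : Finset I, (range fun x => (χ x, {k | ∀ i ∈ Q, k ∈ W i x})).Finite)
    (h : Equiv.Perm ℕ) {Z : Set ℕ} (hZ : Z.Infinite) :
    ∃ Y : Bool → Set ℕ, Disjoint (Y true) (Y false) ∧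
      (∀ x (Q : Finset I), {k | k ∈ Y (χ x) ∧ ∀ i ∈ Q, k ∈ W i x}.Infinite) ∧
      (∀ Q : Finset I, {k | ∃ b, k ∈ Y b ∧ ¬ Admissible W χ Q k b}.Finite) ∧
      (Z \ ⋃ b, Y b).Infinite ∧
      ∀ k, k ∈ ⋃ b, Y b → h k ∈ ⋃ b, Y b → h k = k := by
  classical
  let P := Approx W χ h
  let colour : Finset I → ℕ → Bool × Set ℕ → Set P := fun Q m t =>
    {p | ∃ k ≥ m, p.stem[k]? = some (some t.1) ∧ k ∈ t.2}
  let trace : Finset I → X → Bool × Set ℕ := fun Q x => (χ x, {k | ∀ i ∈ Q, k ∈ W i x})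
  let omit' : ℕ → Set P := fun m => {p | ∃ k ≥ m, k ∈ Z ∧ p.stem[k]? = some none}
  let promise : Finset I → Set P := fun Q => {p | Q ⊆ p.side}
  -- The dense sets of the first kind depend on `x` through its trace only, so that there are
  -- countably many of them for each `Q`.
  let 𝒟 : Set (Set P) := (⋃ Q, ⋃ m, colour Q m '' range (trace Q)) ∪ range omit' ∪ range promise
  have hF := mk_finset_lt_continuum hI
  have hcard : #𝒟 < 𝔠 := by
    refine (mk_union_le _ _).trans_lt (add_lt_of_lt aleph0_le_continuum
      ((mk_union_le _ _).trans_lt (add_lt_of_lt aleph0_le_continuum ?_ ?_)) ?_)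
    · refine (mk_iUnion_le _).trans_lt (mul_lt_of_lt aleph0_le_continuum hF ?_)
      refine (ciSup_le' (a := ℵ₀) fun Q => ?_).trans_lt aleph0_lt_continuum
      exact le_aleph0_iff_set_countable.2
        (countable_iUnion fun m => ((hfin Q).image _).countable)
    · exact (le_aleph0_iff_set_countable.2 (countable_range _)).trans_lt aleph0_lt_continuum
    · exact mk_range_le.trans_lt hF
  have hdense : ∀ D ∈ 𝒟, ForcingDense D := by
    rintro D ((hD | ⟨m, rfl⟩) | ⟨Q, rfl⟩) p
    · simp only [mem_iUnion] at hD
      obtain ⟨Q, m, _, ⟨x, rfl⟩, rfl⟩ := hD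
      obtain ⟨q, hq, k, hk, hqk, hkW⟩ := p.exists_le_colour hW Q x m
      exact ⟨q, ⟨k, hk, hqk, hkW⟩, hq⟩
    · obtain ⟨k, hkZ, hk⟩ := hZ.exists_gt (max m p.stem.length)
      obtain ⟨q, hq, hqk⟩ := p.exists_le_getElem? (k := k) (by omega) none (by simp) (by simp)
      exact ⟨q, ⟨k, by omega, hkZ, hqk⟩, hq⟩
    · obtain ⟨q, hq, -, hqQ⟩ := p.exists_le_side Q
      exact ⟨q, by simp only [promise, mem_ofPred_eq, hqQ]; exact Finset.subset_union_right, hq⟩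
  obtain ⟨G, hG⟩ := hMA P Approx.forcingCCC 𝒟 hcard hdense
  have hdir : ∀ p ∈ G, ∀ q ∈ G, ∃ r ∈ G, r ≤ p ∧ r ≤ q := fun p hp q hq => G.directed p hp q hq
  have hagree : ∀ p ∈ G, ∀ q ∈ G, ∀ (k : ℕ) (u v : Option Bool),
      p.stem[k]? = some u → q.stem[k]? = some v → u = v := by
    intro p hp q hq k u v hu hv
    obtain ⟨r, -, hrp, hrq⟩ := hdir p hp q hq
    have h1 := Approx.getElem?_of_le hrp hu
    rw [Approx.getElem?_of_le hrq hv] at h1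
    exact (Option.some.inj h1).symm
  refine ⟨fun b => {k | ∃ p ∈ G, p.stem[k]? = some (some b)}, ?_, ?_, ?_, ?_, ?_⟩
  · rw [Set.disjoint_left]
    rintro k ⟨p, hp, hpk⟩ ⟨q, hq, hqk⟩
    have := hagree p hp q hq k _ _ hpk hqk
    simp at this
  · intro x Q
    refine infinite_of_forall_exists_gt fun m => ?_
    obtain ⟨p, ⟨k, hk, hpk, hkW⟩, hp⟩ := hG (colour Q (m + 1) (trace Q x))
      (Or.inl (Or.inl (mem_iUnion.2 ⟨Q, mem_iUnion.2 ⟨m + 1, _, ⟨x, rfl⟩, rfl⟩⟩)))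
    exact ⟨k, ⟨⟨p, hp, hpk⟩, hkW⟩, hk⟩
  · intro Q
    obtain ⟨p, hpQ, hp⟩ := hG (promise Q) (Or.inr ⟨Q, rfl⟩)
    refine (finite_lt_nat p.stem.length).subset ?_
    rintro k ⟨b, ⟨q, hq, hqk⟩, hk⟩
    by_contra hlen
    obtain ⟨r, -, hrp, hrq⟩ := hdir p hp q hq
    exact hk ((hrp.2.2 k b (not_lt.1 hlen) (Approx.getElem?_of_le hrq hqk)).mono hpQ)
  · refine infinite_of_forall_exists_gt fun m => ?_
    obtain ⟨p, ⟨k, hk, hkZ, hpk⟩, hp⟩ := hG (omit' (m + 1)) (Or.inl (Or.inr ⟨_, rfl⟩))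
    refine ⟨k, ⟨hkZ, ?_⟩, hk⟩
    simp only [mem_iUnion, not_exists]
    rintro b ⟨q, hq, hqk⟩
    have := hagree p hp q hq k _ _ hpk hqk
    simp at this
  · simp only [mem_iUnion]
    rintro k ⟨b, p, hp, hpk⟩ ⟨b', q, hq, hqk⟩
    obtain ⟨r, -, hrp, hrq⟩ := hdir p hp q hq
    exact r.free k b b' (Approx.getElem?_of_le hrp hpk) (Approx.getElem?_of_le hrq hqk)

/-! ### Deciding a set by a clopen set -/

lemma isLocallyConstant_setOf_forall_mem {I X : Type*} [TopologicalSpace X] {W : I → X → Set ℕ}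
    (hloc : ∀ i, IsLocallyConstant (W i)) (Q : Finset I) :
    IsLocallyConstant fun x => {k | ∀ i ∈ Q, k ∈ W i x} := by
  refine (IsLocallyConstant.iff_eventually_eq _).2 fun x => ?_
  filter_upwards [(Finset.eventually_all Q).2 fun i _ => (hloc i).eventually_eq x] with y hy
  ext k
  exact forall₂_congr fun i hi => by rw [hy i hi]

/-- In an extremally disconnected space some clopen set `c` decides `S`: adjoining `S` at the
parameters in `c` and the complement of `S` at the others preserves the strong finite
intersection property. -/
lemma exists_isClopen_strongFIP_option {I X : Type*} [TopologicalSpace X]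
    [ExtremallyDisconnected X]
    {W : I → X → Set ℕ} (hloc : ∀ i, IsLocallyConstant (W i)) (hW : StrongFIP W) (S : Set ℕ) :
    ∃ c : Set X, IsClopen c ∧
      StrongFIP fun (o : Option I) x => o.elim {k | k ∈ S ↔ x ∈ c} fun i => W i x := by
  classical
  have hnhds : ∀ (x : X) (Q : Finset I), ∀ᶠ y in 𝓝 x,
      {k | ∀ i ∈ Q, k ∈ W i y} = {k | ∀ i ∈ Q, k ∈ W i x} := fun x Q =>
    (isLocallyConstant_setOf_forall_mem hloc Q).eventually_eq x
  -- `U` is the set of parameters at which `S` cannot be adjoined.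
  let U : Set X := {x | ∃ Q : Finset I, (S ∩ {k | ∀ i ∈ Q, k ∈ W i x}).Finite}
  have hU : IsOpen U := by
    refine isOpen_iff_eventually.2 ?_
    rintro x ⟨Q, hQ⟩
    filter_upwards [hnhds x Q] with y hy
    exact ⟨Q, by rwa [hy]⟩
  refine ⟨(closure U)ᶜ, IsClopen.compl ⟨isClosed_closure, ExtremallyDisconnected.open_closure U hU⟩,
    fun x R => ?_⟩
  set Q := R.eraseNone
  suffices h : ({k | k ∈ S ↔ x ∈ (closure U)ᶜ} ∩ {k | ∀ i ∈ Q, k ∈ W i x}).Infinite by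
    refine h.mono ?_
    rintro k ⟨hkS, hk⟩ (_ | i) hi
    · exact hkS
    · exact hk i (Finset.mem_eraseNone.2 hi)
  by_cases hx : x ∈ closure U
  · -- Near `x` there is `y ∈ U` agreeing with `x` on `Q`; there `S` is finite on a finite
    -- intersection, so that its complement meets the intersection over `Q` in an infinite set.
    obtain ⟨y, hyQ, Q', hQ'⟩ :=
      (mem_closure_iff_frequently.1 hx).and_eventually (hnhds x Q) |>.exists.imp fun _ h => h.symm
    rw [← hyQ]
    refine ((hW y (Q ∪ Q')).sdiff hQ').mono ?_
    rintro k ⟨hk, hkS⟩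
    refine ⟨?_, fun i hi => hk i (Finset.mem_union_left _ hi)⟩
    simp only [mem_ofPred_eq, mem_compl_iff, hx, not_true_eq_false, iff_false]
    exact fun h => hkS ⟨h, fun i hi => hk i (Finset.mem_union_right _ hi)⟩
  · have hxU : x ∉ U := fun h => hx (subset_closure h)
    refine Set.Infinite.mono ?_ (not_exists.1 hxU Q)
    rintro k ⟨hkS, hk⟩
    exact ⟨by simp [hkS, hx], hk⟩

/-! ### The recursion -/

/-- The requirements on a new member `V` of the family `W`. It preserves the strong finite
intersection property, and almost every number in its union lies in prescribed finitely many
earlier members at a common parameter. It decides `S` and separates the parameters in `a` from the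
others. Its union does not almost contain `S` if `S` is infinite, and is moved off itself by `h`,
up to fixed points. -/
structure IsStep {I X : Type*} [TopologicalSpace X] (W : I → X → Set ℕ) (S : Set ℕ) (a : Set X)
    (h : Equiv.Perm ℕ) (V : X → Set ℕ) : Prop where
  isLocallyConstant : IsLocallyConstant V
  infinite : ∀ x (Q : Finset I), {k | k ∈ V x ∧ ∀ i ∈ Q, k ∈ W i x}.Infinite
  finite : ∀ Q : Finset I, {k | k ∈ ⋃ x, V x ∧ ¬ ∃ x, ∀ i ∈ Q, k ∈ W i x}.Finite
  decides : ∃ c, IsClopen c ∧ ∀ x, ∀ k ∈ V x, k ∈ S ↔ x ∈ c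
  disjoint : ∀ x ∈ a, ∀ y ∉ a, Disjoint (V x) (V y)
  infinite_sdiff : S.Infinite → (S \ ⋃ x, V x).Infinite
  free : ∀ k ∈ ⋃ x, V x, h k ∈ ⋃ x, V x → h k = k

lemma IsClopen.isLocallyConstant_mem {X : Type*} [TopologicalSpace X] {c : Set X}
    (hc : IsClopen c) : IsLocallyConstant fun x => x ∈ c := by
  refine (IsLocallyConstant.iff_eventually_eq _).2 fun x => ?_
  by_cases hx : x ∈ c
  · filter_upwards [hc.isOpen.mem_nhds hx] with y hy
    simp [hx, hy]
  · filter_upwards [hc.compl.isOpen.mem_nhds hx] with y hy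
    simpa [hx] using hy

lemma MartinsAxiom.exists_isStep (hMA : MartinsAxiom) {I : Type} {X : Type*} [TopologicalSpace X]
    [Nonempty X] [CompactSpace X] [ExtremallyDisconnected X] (hI : #I < 𝔠) {W : I → X → Set ℕ}
    (hloc : ∀ i, IsLocallyConstant (W i)) (hW : StrongFIP W) (S : Set ℕ) {a : Set X}
    (ha : IsClopen a) (h : Equiv.Perm ℕ) : ∃ V, IsStep W S a h V := by
  classical
  obtain ⟨c, hc, hWc⟩ := exists_isClopen_strongFIP_option hloc hW S
  set W' : Option I → X → Set ℕ := fun o x => o.elim {k | k ∈ S ↔ x ∈ c} fun i => W i x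
  have hlocS := hc.isLocallyConstant_mem.comp fun q => {k | k ∈ S ↔ q}
  have hloc' : ∀ o, IsLocallyConstant (W' o) := by
    rintro (_ | i)
    · exact hlocS
    · exact hloc i
  have hχ : IsLocallyConstant fun x => decide (x ∈ a) :=
    ha.isLocallyConstant_mem.comp fun q => decide q
  have hI' : #(Option I) < 𝔠 := by
    rw [mk_option]
    exact add_lt_of_lt aleph0_le_continuum hI (one_lt_aleph0.trans aleph0_lt_continuum)
  obtain ⟨Y, hY, hinf, hfin, hsdiff, hfree⟩ := hMA.exists_extension hI' hWc
    (fun x => decide (x ∈ a))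
    (fun Q => (hχ.prodMk (isLocallyConstant_setOf_forall_mem hloc' Q)).range_finite) h
    (Z := if S.Infinite then S else univ) (by split_ifs with hS; exacts [hS, infinite_univ])
  let V : X → Set ℕ := fun x => {k | k ∈ S ↔ x ∈ c} ∩ Y (decide (x ∈ a))
  have hVY : ⋃ x, V x ⊆ ⋃ b, Y b :=
    iUnion_subset fun x => inter_subset_right.trans (subset_iUnion Y _)
  refine ⟨V, hlocS.comp₂ hχ fun s b => s ∩ Y b, ?_, ?_, ⟨c, hc, fun x k hk => hk.1⟩, ?_, ?_,
    fun k hk hk' => hfree k (hVY hk) (hVY hk')⟩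
  · intro x Q
    refine (hinf x (insert none (Q.map Function.Embedding.some))).mono ?_
    rintro k ⟨hkY, hk⟩
    exact ⟨⟨hk none (by simp), hkY⟩, fun i hi => hk (some i) (by simpa using hi)⟩
  · intro Q
    refine (hfin (Q.map Function.Embedding.some)).subset ?_
    rintro k ⟨hkV, hk⟩
    obtain ⟨b, hb⟩ := mem_iUnion.1 (hVY hkV)
    refine ⟨b, hb, ?_⟩
    rintro ⟨x, -, hx⟩
    exact hk ⟨x, fun i hi => hx (some i) (by simpa using hi)⟩
  · intro x hx y hy
    have : Disjoint (Y (decide (x ∈ a))) (Y (decide (y ∈ a))) := by simpa [hx, hy] using hY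
    exact this.mono inter_subset_right inter_subset_right
  · intro hS
    rw [if_pos hS] at hsdiff
    exact hsdiff.mono (sdiff_subset_sdiff_right hVY)

section Recursion

variable {T X : Type*} [LinearOrder T] [TopologicalSpace X] {W : T → X → Set ℕ}
  {S : T → Set ℕ} {a : T → Set X} {h : T → Equiv.Perm ℕ}

/-- The property at `x` of a finite subfamily is contained in the step at its largest index. -/
lemma StrongFIP.of_isStep {γ : T} (hstep : ∀ δ < γ,
    IsStep (fun i : Iio δ => W i) (S δ) (a δ) (h δ) (W δ)) :
    StrongFIP fun i : Iio γ => W i := by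
  classical
  intro x Q
  rcases Q.eq_empty_or_nonempty with rfl | hQ
  · simpa using infinite_univ
  obtain ⟨δ, hδ, hmax⟩ := Q.exists_max_image Subtype.val hQ
  refine ((hstep δ δ.2).infinite x ((Q.image Subtype.val).subtype (· ∈ Iio (δ : T)))).mono ?_
  rintro k ⟨hkδ, hk⟩ i hi
  rcases (hmax i hi).lt_or_eq with hlt | heq
  · refine hk ⟨i, hlt⟩ ?_
    simp only [Finset.mem_subtype, Finset.mem_image]
    exact ⟨i, hi, rfl⟩
  · rwa [Subtype.ext heq]

end Recursion

/-- A transfinite recursion in which every step meets the requirements assigned to it. It is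
defined with an arbitrary value wherever no suitable member exists; by induction this never
happens. -/
lemma MartinsAxiom.exists_forall_isStep (hMA : MartinsAxiom) {T : Type} [LinearOrder T]
    [WellFoundedLT T] (hT : ∀ γ : T, #(Iio γ) < 𝔠) {X : Type*} [TopologicalSpace X]
    [Nonempty X] [CompactSpace X] [ExtremallyDisconnected X] (S : T → Set ℕ) (a : T → Set X)
    (ha : ∀ γ, IsClopen (a γ)) (h : T → Equiv.Perm ℕ) :
    ∃ W : T → X → Set ℕ, ∀ γ, IsStep (fun i : Iio γ => W i) (S γ) (a γ) (h γ) (W γ) := by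
  let W : T → X → Set ℕ := (wellFounded_lt (α := T)).fix fun γ W =>
    Classical.epsilon fun V => IsStep (fun i : Iio γ => W i i.2) (S γ) (a γ) (h γ) V
  have hfix : ∀ γ, W γ = Classical.epsilon fun V =>
      IsStep (fun i : Iio γ => W i) (S γ) (a γ) (h γ) V := fun γ =>
    (wellFounded_lt (α := T)).fix_eq _ γ
  refine ⟨W, fun γ => ?_⟩
  induction γ using WellFoundedLT.induction with
  | ind γ ih =>
    have hex := hMA.exists_isStep (hT γ) (fun i : Iio γ => (ih i i.2).isLocallyConstant)
      (StrongFIP.of_isStep ih) (S γ) (ha γ) (h γ)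
    rw [hfix γ]
    exact Classical.epsilon_spec hex

/-! ### The space `ω*` and almost decreasing families -/

lemma OmegaStar.le_cofinite (p : OmegaStar) : (p.1 : Filter ℕ) ≤ cofinite := by
  rcases p.1.le_cofinite_or_eq_pure with h | ⟨n, h⟩
  · exact h
  · exact (p.2 ⟨n, h.symm⟩).elim

instance : CompactSpace OmegaStar := by
  refine isCompact_iff_compactSpace.1 (IsClosed.isCompact (s := {p : Ultrafilter ℕ | p ∉ _}) ?_)
  refine isOpen_compl_iff.1 ?_
  have : {p : Ultrafilter ℕ | p ∉ range (pure : ℕ → Ultrafilter ℕ)}ᶜ =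
      ⋃ n, {p : Ultrafilter ℕ | {n} ∈ p} := by
    ext p
    simp only [mem_compl_iff, mem_ofPred_eq, not_not, mem_iUnion, mem_range]
    constructor
    · rintro ⟨n, rfl⟩
      exact ⟨n, rfl⟩
    · rintro ⟨n, hn⟩
      exact ⟨n, Ultrafilter.coe_le_coe.1 ((pure n : Ultrafilter ℕ).unique (le_pure_iff.2 hn)).ge⟩
  rw [this]
  exact isOpen_iUnion fun n => ultrafilter_isOpen_basic _

lemma OmegaStar.isClopen_setOf_mem (B : Set ℕ) : IsClopen {p : OmegaStar | B ∈ p.1} :=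
  ⟨(ultrafilter_isClosed_basic B).preimage continuous_subtype_val,
    (ultrafilter_isOpen_basic B).preimage continuous_subtype_val⟩

lemma isClosed_stoneSet (F : Filter ℕ) : IsClosed (stoneSet F) := by
  have : stoneSet F = ⋂ B ∈ F, {p : OmegaStar | B ∈ p.1} := by
    ext p
    simp [stoneSet]
  rw [this]
  exact isClosed_biInter fun B _ => (OmegaStar.isClopen_setOf_mem B).isClosed

section AlmostDecreasing

variable {T : Type*} [LinearOrder T] {A : T → Set ℕ}

lemma mem_generate_cofinite_union_range [Nonempty T] (hA : ∀ α β, α < β → (A β \ A α).Finite)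
    {B : Set ℕ} : B ∈ generate (cofinite.sets ∪ range A) ↔ ∃ γ, (A γ \ B).Finite := by
  have hA' : ∀ {α β}, α ≤ β → (A β \ A α).Finite := by
    intro α β hαβ
    rcases hαβ.eq_or_lt with rfl | h
    · simp
    · exact hA α β h
  constructor
  · intro hB
    induction hB with
    | basic hB =>
      rcases hB with hB | ⟨γ, rfl⟩
      · exact ⟨Classical.arbitrary T, (mem_cofinite.1 hB).subset fun k hk => hk.2⟩
      · exact ⟨γ, by simp⟩
    | univ => exact ⟨Classical.arbitrary T, by simp⟩
    | superset _ hBC ih =>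
      obtain ⟨γ, hγ⟩ := ih
      exact ⟨γ, hγ.subset (sdiff_subset_sdiff_right hBC)⟩
    | inter _ _ ih₁ ih₂ =>
      obtain ⟨γ₁, h₁⟩ := ih₁
      obtain ⟨γ₂, h₂⟩ := ih₂
      refine ⟨max γ₁ γ₂, (((hA' (le_max_left γ₁ γ₂)).union (hA' (le_max_right γ₁ γ₂))).union
        (h₁.union h₂)).subset ?_⟩
      rintro k ⟨hk, hk'⟩
      simp only [mem_inter_iff, not_and_or] at hk'
      simp only [mem_union, Set.mem_sdiff]
      tauto
  · rintro ⟨γ, hγ⟩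
    have h₁ : A γ ∈ generate (cofinite.sets ∪ range A) := .basic (Or.inr ⟨γ, rfl⟩)
    have h₂ : (A γ \ B)ᶜ ∈ generate (cofinite.sets ∪ range A) :=
      .basic (Or.inl hγ.compl_mem_cofinite)
    filter_upwards [h₁, h₂] with k hk hk'
    by_contra hB
    exact hk' ⟨hk, hB⟩

lemma mem_stoneSet_generate_iff [Nonempty T] (hA : ∀ α β, α < β → (A β \ A α).Finite)
    {p : OmegaStar} :
    p ∈ stoneSet (generate (cofinite.sets ∪ range A)) ↔ ∀ γ, A γ ∈ p.1 := by
  constructor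
  · exact fun h γ => h _ (.basic (Or.inr ⟨γ, rfl⟩))
  · intro h B hB
    obtain ⟨γ, hγ⟩ := (mem_generate_cofinite_union_range hA).1 hB
    filter_upwards [h γ, p.le_cofinite hγ.compl_mem_cofinite] with k hk hk'
    by_contra hkB
    exact hk' ⟨hk, hkB⟩

/-- By compactness, the traces on `ω*` of the sets `A γ` form a neighbourhood base of the closed
set that they generate. -/
lemma exists_setOf_mem_subset_of_mem_nhdsSet [Nonempty T] (hA : ∀ α β, α < β → (A β \ A α).Finite)
    {U : Set OmegaStar} (hU : U ∈ 𝓝ˢ (stoneSet (generate (cofinite.sets ∪ range A)))) :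
    ∃ γ, {p : OmegaStar | A γ ∈ p.1} ⊆ U := by
  obtain ⟨V, hVo, hKV, hVU⟩ := mem_nhdsSet_iff_exists.1 hU
  have hmono : ∀ {α β}, α ≤ β → {p : OmegaStar | A β ∈ p.1} ⊆ {p : OmegaStar | A α ∈ p.1} := by
    intro α β hαβ p hp
    rcases hαβ.eq_or_lt with rfl | h
    · exact hp
    · filter_upwards [hp, p.le_cofinite (hA α β h).compl_mem_cofinite] with k hk hk'
      by_contra hkα
      exact hk' ⟨hk, hkα⟩
  obtain ⟨γ, hγ⟩ := hVo.isClosed_compl.isCompact.elim_directed_family_closed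
    (fun γ => {p : OmegaStar | A γ ∈ p.1}) (fun γ => (OmegaStar.isClopen_setOf_mem _).isClosed)
    (by
      refine eq_empty_of_forall_notMem ?_
      rintro p ⟨hpV, hp⟩
      exact hpV (hKV ((mem_stoneSet_generate_iff hA).2 (mem_iInter.1 hp))))
    (fun α β => ⟨max α β, hmono (le_max_left _ _), hmono (le_max_right _ _)⟩)
  refine ⟨γ, fun p hp => hVU ?_⟩
  by_contra hpV
  exact eq_empty_iff_forall_notMem.1 hγ p ⟨hpV, hp⟩

lemma isPSet_stoneSet_generate [Nonempty T] (hA : ∀ α β, α < β → (A β \ A α).Finite)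
    (hT : ∀ f : ℕ → T, ∃ γ, ∀ n, f n < γ) :
    IsPSet (stoneSet (generate (cofinite.sets ∪ range A))) := by
  refine ⟨isClosed_stoneSet _, fun U hU => ?_⟩
  choose f hf using fun n => exists_setOf_mem_subset_of_mem_nhdsSet hA (hU n)
  obtain ⟨γ, hγ⟩ := hT f
  refine mem_nhdsSet_iff_exists.2 ⟨_, (OmegaStar.isClopen_setOf_mem (A γ)).isOpen,
    fun p hp => (mem_stoneSet_generate_iff hA).1 hp γ, fun p hp => mem_iInter.2 fun n => hf n ?_⟩
  filter_upwards [hp, p.le_cofinite (hA _ _ (hγ n)).compl_mem_cofinite] with k hk hk'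
  by_contra hkn
  exact hk' ⟨hk, hkn⟩

end AlmostDecreasing

/-! ### Reversibility -/

/-- A continuous bijection of `ξ(F)` fixes the point `F` and permutes `ω` by some `h` under which
preimages of sets in `F` are in `F`. If some `A ∈ F` meets its preimage under `h` in fixed points
only, then `h` is the identity on a set in `F`, so that the bijection is open. -/
lemma reversibleFilter_of_forall_perm {F : Filter ℕ} [F.NeBot]
    (hF : ∀ h : Equiv.Perm ℕ, ∃ A ∈ F, ∀ k ∈ A, h k ∈ A → h k = k) : ReversibleFilter F := by
  intro f hf hbij
  have hopen : ∀ U : Set (FilterSpace F), IsOpen U ↔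
      ((none : Option ℕ) ∈ U → {n : ℕ | (some n : Option ℕ) ∈ U} ∈ F) := fun U => Iff.rfl
  let e : Equiv.Perm (Option ℕ) := Equiv.ofBijective f hbij
  have he : ∀ o, e o = f o := fun o => rfl
  have hnone : e none = none := by
    by_contra hne
    obtain ⟨n, hn⟩ := Option.ne_none_iff_exists'.1 hne
    have h₁ : IsOpen ({e none} : Set (FilterSpace F)) :=
      (hopen _).2 fun h => (hne (mem_singleton_iff.1 h).symm).elim
    have h₂ := (hopen _).1 (h₁.preimage hf) rfl
    refine F.empty_notMem (mem_of_superset h₂ fun m hm => ?_)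
    -- `e` takes the value `e none` at `none` only, so that this preimage has an empty trace on `ω`.
    have := e.injective (mem_singleton_iff.1 hm : e (some m) = e none)
    cases this
  let h : Equiv.Perm ℕ := Equiv.removeNone e
  have hsome : ∀ n, e (some n) = some (h n) := fun n => by
    refine (Equiv.removeNone_some e (Option.ne_none_iff_exists'.1 fun hn => ?_)).symm
    cases e.injective (hn.trans hnone.symm)
  obtain ⟨A, hA, hAh⟩ := hF h
  have hpre : h ⁻¹' A ∈ F := by
    have h₁ : IsOpen (insert none (some '' A) : Set (FilterSpace F)) :=
      (hopen _).2 fun _ => mem_of_superset hA fun n hn => Or.inr ⟨n, hn, rfl⟩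
    refine mem_of_superset ((hopen _).1 (h₁.preimage hf) (Or.inl hnone)) fun n hn => ?_
    have hn' : e (some n) ∈ (insert none (some '' A) : Set (Option ℕ)) := hn
    rw [hsome] at hn'
    simpa using hn'
  have hfix : {k | h k = k} ∈ F := by
    filter_upwards [hA, hpre] with k hk hk' using hAh k hk hk'
  refine ⟨hf, fun U hU => (hopen _).2 ?_, hbij⟩
  rintro ⟨o, ho, ho'⟩
  obtain rfl : o = none := e.injective (ho'.trans hnone.symm)
  filter_upwards [(hopen U).1 hU ho, hfix] with k hk hkh
  exact ⟨some k, hk, (hsome k).trans (congrArg some hkh)⟩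

/-! ### The homeomorphism -/

/-- A family with the strong finite intersection property at `x` is contained in a non-principal
ultrafilter. -/
lemma StrongFIP.exists_omegaStar {I X : Type*} {W : I → X → Set ℕ} (hW : StrongFIP W) (x : X) :
    ∃ p : OmegaStar, ∀ i, W i x ∈ p.1 := by
  classical
  let L : Filter ℕ := ⨅ Q : Finset I, cofinite ⊓ 𝓟 {k | ∀ i ∈ Q, k ∈ W i x}
  have : L.NeBot := by
    refine iInf_neBot_of_directed' (fun Q R => ⟨Q ∪ R, ?_, ?_⟩) fun Q =>
      cofinite_inf_principal_neBot_iff.2 (hW x Q)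
    · exact inf_le_inf_left _ (principal_mono.2 fun k hk i hi =>
        hk i (Finset.mem_union_left _ hi))
    · exact inf_le_inf_left _ (principal_mono.2 fun k hk i hi =>
        hk i (Finset.mem_union_right _ hi))
  have hcof : (Ultrafilter.of L : Filter ℕ) ≤ cofinite :=
    (Ultrafilter.of_le L).trans ((iInf_le _ ∅).trans inf_le_left)
  refine ⟨⟨Ultrafilter.of L, ?_⟩, fun i => ?_⟩
  · rintro ⟨n, hn⟩
    have : ({n}ᶜ : Set ℕ) ∈ Ultrafilter.of L := hcof (finite_singleton n).compl_mem_cofinite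
    rw [← hn] at this
    exact this rfl
  · refine Ultrafilter.of_le L (mem_of_superset (mem_iInf_of_mem {i}
      (mem_inf_of_right (mem_principal_self _))) fun k hk => hk i (by simp))

/-- If every finite subfamily can be realised at a common parameter on a set of `p`, then the whole
family can be realised in `p` at one parameter. -/
lemma exists_forall_mem_of_compactSpace {I X : Type*} [TopologicalSpace X] [CompactSpace X]
    {W : I → X → Set ℕ} (hloc : ∀ i, IsLocallyConstant (W i)) {p : Ultrafilter ℕ}
    (hp : ∀ Q : Finset I, {k | ∃ x, ∀ i ∈ Q, k ∈ W i x} ∈ p) : ∃ x, ∀ i, W i x ∈ p := by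
  have hclosed : ∀ i, IsClosed {x | W i x ∈ p} := fun i =>
    ⟨(hloc i) {B | B ∈ p}ᶜ⟩
  have := CompactSpace.iInter_nonempty hclosed fun Q => by
    have hfin := (isLocallyConstant_setOf_forall_mem hloc Q).range_finite
    obtain ⟨_, ⟨x, rfl⟩, hx⟩ := (Ultrafilter.finite_sUnion_mem_iff hfin).1
      (mem_of_superset (hp Q) fun k ⟨x, hx⟩ => ⟨_, ⟨x, rfl⟩, hx⟩)
    exact ⟨x, mem_iInter₂.2 fun i hi => mem_of_superset hx fun k hk => hk i hi⟩
  exact this.imp fun x hx i => mem_iInter.1 hx i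

section Steps

variable {T X : Type*} [LinearOrder T] [TopologicalSpace X] {W : T → X → Set ℕ}
  {S : T → Set ℕ} {a : T → Set X} {h : T → Equiv.Perm ℕ}

lemma StrongFIP.of_forall_isStep [NoMaxOrder T] [Nonempty T]
    (hstep : ∀ γ, IsStep (fun i : Iio γ => W i) (S γ) (a γ) (h γ) (W γ)) : StrongFIP W := by
  classical
  intro x Q
  obtain ⟨γ, hγ⟩ := Q.exists_le
  obtain ⟨δ, hδ⟩ := exists_gt γ
  refine (StrongFIP.of_isStep (γ := δ) (fun i _ => hstep i) x
    (Q.subtype (· ∈ Iio δ))).mono fun k hk i hi => ?_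
  exact hk ⟨i, (hγ i hi).trans_lt hδ⟩ (by simpa using hi)

lemma finite_iUnion_sdiff_of_forall_isStep
    (hstep : ∀ γ, IsStep (fun i : Iio γ => W i) (S γ) (a γ) (h γ) (W γ)) (Q : Finset T) {γ : T}
    (hQ : ∀ i ∈ Q, i < γ) : ((⋃ x, W γ x) \ {k | ∃ x, ∀ i ∈ Q, k ∈ W i x}).Finite := by
  classical
  refine ((hstep γ).finite (Q.subtype (· ∈ Iio γ))).subset ?_
  rintro k ⟨hk, hk'⟩
  refine ⟨hk, fun ⟨x, hx⟩ => hk' ⟨x, fun i hi => hx ⟨i, hQ i hi⟩ (by simpa using hi)⟩⟩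

/-- The points of `X` correspond to the points of `ω*` in the traces of all the unions
`⋃ x, W γ x`: the point `x` to the unique ultrafilter that contains all `W γ x`. -/
lemma nonempty_homeomorph_of_forall_isStep [CompactSpace X] [TotallySeparatedSpace X]
    [NoMaxOrder T] [Nonempty T]
    (hstep : ∀ γ, IsStep (fun i : Iio γ => W i) (S γ) (a γ) (h γ) (W γ))
    (hS : ∀ B, ∃ γ, S γ = B) (ha : ∀ c, IsClopen c → ∃ γ, a γ = c) {K : Set OmegaStar}
    (hK : ∀ p, p ∈ K ↔ ∀ γ, (⋃ x, W γ x) ∈ p.1) : Nonempty (X ≃ₜ K) := by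
  choose φ hφ using (StrongFIP.of_forall_isStep hstep).exists_omegaStar
  have hdec : ∀ B, ∃ c, IsClopen c ∧
      ∀ (p : OmegaStar) x, (∀ γ, W γ x ∈ p.1) → (B ∈ p.1 ↔ x ∈ c) := by
    intro B
    obtain ⟨γ, rfl⟩ := hS B
    obtain ⟨c, hc, hdec⟩ := (hstep γ).decides
    refine ⟨c, hc, fun p x hp => ⟨fun hB => ?_, fun hx => ?_⟩⟩
    · obtain ⟨k, hk, hk'⟩ := p.1.nonempty_of_mem (inter_mem hB (hp γ))
      exact (hdec x k hk').1 hk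
    · exact mem_of_superset (hp γ) fun k hk => (hdec x k hk).2 hx
  have hcont : Continuous φ := by
    refine continuous_induced_rng.2
      ((ultrafilterBasis_is_basis (α := ℕ)).continuous_iff.2 ?_)
    rintro _ ⟨B, rfl⟩
    obtain ⟨c, hc, hBc⟩ := hdec B
    convert hc.isOpen using 1
    ext x
    exact hBc _ x (hφ x)
  have hinj : Function.Injective φ := by
    intro x y hxy
    by_contra hne
    obtain ⟨c, hc, hx, hy⟩ := exists_isClopen_of_totally_separated hne
    obtain ⟨γ, rfl⟩ := ha c hc
    have h₁ := hφ x γ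
    rw [hxy] at h₁
    obtain ⟨k, hk, hk'⟩ := (φ y).1.nonempty_of_mem (inter_mem h₁ (hφ y γ))
    exact Set.disjoint_left.1 ((hstep γ).disjoint x hx y hy) hk hk'
  have hrange : range φ = K := by
    refine Subset.antisymm ?_ fun p hp => ?_
    · rintro _ ⟨x, rfl⟩
      exact (hK _).2 fun γ => mem_of_superset (hφ x γ) (subset_iUnion _ x)
    · obtain ⟨x, hx⟩ := exists_forall_mem_of_compactSpace (p := p.1)
        (fun γ => (hstep γ).isLocallyConstant) fun Q => by
          obtain ⟨γ, hγ⟩ := Q.exists_le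
          obtain ⟨δ, hδ⟩ := exists_gt γ
          have hfin := finite_iUnion_sdiff_of_forall_isStep hstep Q
            fun i hi => (hγ i hi).trans_lt hδ
          filter_upwards [(hK p).1 hp δ, p.le_cofinite hfin.compl_mem_cofinite] with k hk hk'
          by_contra hkQ
          exact hk' ⟨hk, hkQ⟩
      refine ⟨x, Subtype.ext (Ultrafilter.ext fun B => ?_)⟩
      obtain ⟨c, -, hBc⟩ := hdec B
      rw [hBc _ x (hφ x), hBc _ x hx]
  have hemb := hcont.isClosedEmbedding hinj
  exact ⟨hemb.isEmbedding.toHomeomorph.trans (Homeomorph.setCongr hrange)⟩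

end Steps

/-! ### Enumerations of length `𝔠` -/

/-- The clopen sets of a separable space are indexed by the subsets of `ℕ`: a clopen set is the
closure of its trace on a countable dense set. Indices with other closures yield `univ`. -/
lemma exists_enumeration_isClopen (X : Type*) [TopologicalSpace X] [Nonempty X]
    [TopologicalSpace.SeparableSpace X] :
    ∃ a : Set ℕ → Set X, (∀ N, IsClopen (a N)) ∧ ∀ c, IsClopen c → ∃ N, a N = c := by
  classical
  let d := TopologicalSpace.denseSeq X
  refine ⟨fun N => if IsClopen (closure (d '' N)) then closure (d '' N) else univ, fun N => ?_,
    fun c hc => ⟨d ⁻¹' c, ?_⟩⟩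
  · dsimp only
    split_ifs with hN
    exacts [hN, isClopen_univ]
  · have : closure (d '' (d ⁻¹' c)) = c := by
      rw [image_preimage_eq_inter_range]
      exact (closure_minimal inter_subset_left hc.isClosed).antisymm
        ((TopologicalSpace.denseRange_denseSeq X).open_subset_closure_inter hc.isOpen)
    dsimp only
    rw [this, if_pos hc]

/-- König's theorem: `𝔠` has uncountable cofinality. -/
lemma exists_gt_of_nat_ord_continuum (f : ℕ → (ord (𝔠 : Cardinal.{0})).ToType) :
    ∃ γ, ∀ n, f n < γ := by
  have hcof : ℵ₀ < Order.cof (ord 𝔠).ToType := by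
    rw [Ordinal.cof_toType, ← two_power_aleph0]
    exact lt_cof_ord_power le_rfl one_lt_two
  have hf : ¬ IsCofinal (range f) := fun h =>
    ((Order.cof_le h).trans (le_aleph0_iff_set_countable.2 (countable_range f))).not_gt hcof
  obtain ⟨γ, hγ⟩ := not_isCofinal_iff.1 hf
  exact ⟨γ, fun n => hγ _ ⟨n, rfl⟩⟩

lemma exists_surjective_ord_continuum_toType :
    ∃ e : (ord (𝔠 : Cardinal.{0})).ToType → Set ℕ × Set ℕ × Equiv.Perm ℕ,
      Function.Surjective e := by
  have hle : #(Set ℕ × Set ℕ × Equiv.Perm ℕ) ≤ #(ord (𝔠 : Cardinal.{0})).ToType := by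
    have hperm : #(Equiv.Perm ℕ) ≤ 𝔠 :=
      (mk_le_of_injective (f := fun h : Equiv.Perm ℕ => (h : ℕ → ℕ))
        DFunLike.coe_injective).trans (by simp)
    rw [mk_ord_toType, mk_prod, mk_prod]
    simp only [lift_id, mk_set_nat]
    exact mul_le_of_le aleph0_le_continuum le_rfl (mul_le_of_le aleph0_le_continuum le_rfl hperm)
  obtain ⟨g⟩ := le_def _ _ |>.1 hle
  exact ⟨Function.invFun g, Function.invFun_surjective g.injective⟩

/-! ### The tower and its filter -/

theorem mainTheorem6 (hMA : MartinsAxiom) {X : Type*} [TopologicalSpace X] [Nonempty X]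
    [CompactSpace X] [T2Space X] [TopologicalSpace.SeparableSpace X] [ExtremallyDisconnected X] :
    ∃ F : Filter ℕ, F.NeBot ∧ F ≤ cofinite ∧ ReversibleFilter F ∧
      GeneratedByTower (Cardinal.ord 𝔠) F ∧ IsPSet (stoneSet F) ∧
      Nonempty (X ≃ₜ stoneSet F) := by
  let T := (ord (𝔠 : Cardinal.{0})).ToType
  obtain ⟨e, he⟩ := exists_surjective_ord_continuum_toType
  obtain ⟨a, ha, hasurj⟩ := exists_enumeration_isClopen X
  have hT := exists_gt_of_nat_ord_continuum
  have : NoMaxOrder T := ⟨fun γ => (hT fun _ => γ).imp fun δ hδ => hδ 0⟩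
  have : Nonempty T := ⟨(he (∅, ∅, 1)).choose⟩
  obtain ⟨W, hW⟩ := hMA.exists_forall_isStep (T := T)
    (fun γ => (mk_Iio_lt γ (by simp [T])).trans_eq (by simp [T]))
    (fun γ => (e γ).1) (fun γ => a (e γ).2.1) (fun γ => ha _) (fun γ => (e γ).2.2)
  let A : T → Set ℕ := fun γ => ⋃ x, W γ x
  have hA : ∀ α β, α < β → (A β \ A α).Finite := by
    intro α β hαβ
    refine (finite_iUnion_sdiff_of_forall_isStep hW {α} (γ := β) (by simpa using hαβ)).subset ?_
    refine sdiff_subset_sdiff_right ?_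
    rintro k ⟨x, hx⟩
    exact mem_iUnion.2 ⟨x, hx α (by simp)⟩
  have hAF : ∀ γ, A γ ∈ generate (cofinite.sets ∪ range A) := fun γ => .basic (Or.inr ⟨γ, rfl⟩)
  have hne : (generate (cofinite.sets ∪ range A)).NeBot := by
    obtain ⟨x⟩ := ‹Nonempty X›
    obtain ⟨p, hp⟩ := (StrongFIP.of_forall_isStep hW).exists_omegaStar x
    refine p.1.neBot.mono (le_generate_iff.2 ?_)
    rintro B (hB | ⟨γ, rfl⟩)
    · exact p.le_cofinite hB
    · exact mem_of_superset (hp γ) (subset_iUnion _ x)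
  refine ⟨generate (cofinite.sets ∪ range A), hne, fun B hB => .basic (Or.inl hB),
    reversibleFilter_of_forall_perm fun h => ?_, ?_, isPSet_stoneSet_generate hA hT,
    nonempty_homeomorph_of_forall_isStep hW ?_ ?_ fun p => mem_stoneSet_generate_iff hA⟩
  · obtain ⟨γ, hγ⟩ := he (∅, ∅, h)
    have := (hW γ).free
    rw [hγ] at this
    exact ⟨A γ, hAF γ, this⟩
  · refine ⟨fun α => A (Ordinal.ToType.mk α), ⟨fun α β hαβ => hA _ _ (by simpa using hαβ), ?_⟩, ?_⟩
    · rintro ⟨B, hB, hBA⟩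
      -- The step that deals with `B` omits infinitely many elements of `B`.
      obtain ⟨γ, hγ⟩ := he (B, ∅, 1)
      have := (hW γ).infinite_sdiff
      rw [hγ] at this
      refine this hB ?_
      simpa using hBA (Ordinal.ToType.mk.symm γ)
    · rw [← Ordinal.ToType.mk.surjective.range_comp A]
      rfl
  · intro B
    obtain ⟨γ, hγ⟩ := he (B, ∅, 1)
    exact ⟨γ, by rw [hγ]⟩
  · intro c hc
    obtain ⟨N, hN⟩ := hasurj c hc
    obtain ⟨γ, hγ⟩ := he (∅, N, 1)
    exact ⟨γ, by rw [hγ, hN]⟩
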